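/- Fix a unit vector $e_1\in\mathbb R^4$. Let $w=a_1a_2\cdots a_n$ be a non-empty word in the letters $0,1,2$. The sequential graph $G_w$ has two labelled vertices $0,1$ and a chain of vertices $v_1,\dots,v_n$, with edges $v_iv_{i+1}$ for $1\le i<n$, and with an edge from $v_i$ to $0$ if $a_i\in\{0,2\}$ and an edge from $v_i$ to $1$ if $a_i\in\{1,2\}$. Adding a third labelled vertex $z$ and an edge from $v_n$ to $z$ gives the graph of the sequential function of $w$. Place the vertex $0$ at the origin, the vertex $1$ at $e_1$, the vertex $z$ at a point $z\in\mathbb R^4\setminus\{0,e_1\}$, and $v_i$ at $x_i\in\mathbb R^4$, and let $Q_e$ be the squared Euclidean distance between the end points of an edge $e$. Define the sequential function in four dimensions and the sequential period by $$f_w(z)=\int_{(\mathbb R^4)^n}\frac{1}{\prod_e Q_e}\prod_{i=1}^n\frac{\mathrm d^4x_i}{\pi^2},\qquad P(G_w)=\int_{(\mathbb R^4)^n}\frac{1}{\prod_e Q_e}\prod_{i=1}^n\frac{\mathrm d^4x_i}{\pi^2},$$ where the product over $e$ runs over all edges of the graph of the sequential function of $w$ in the first case, and over all edges of $G_w$ in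 the second. Then: 1. For every $z\in\mathbb R^4\setminus\{0,e_1\}$, the integral $f_w(z)$ converges (the sequential function is well defined) if and only if $w$ begins with $2$, that is, $a_1=2$. 2. The integral $P(G_w)$ converges (the sequential period is well defined) if and only if $n\ge2$ and $w$ begins and ends with $2$, that is, $w=2u2$ for some (possibly empty) word $u$. -/

import Mathlib

open scoped ENNReal

/-- Four-dimensional Euclidean space. -/
abbrev E4 : Type := EuclideanSpace ℝ (Fin 4)

/-- The quadric `Q_e = ‖y a - y b‖ ^ 2` of an edge `e` with endpoints `a`, `b`, where the vertices of
the graph are placed at the points `y` of `ℝ⁴`. -/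
noncomputable def quadric {α : Type} (y : α → E4) (e : Sym2 α) : ℝ :=
  Sym2.lift ⟨fun a b => ‖y a - y b‖ ^ 2, fun a b => by simp only [norm_sub_rev]⟩ e

open scoped Classical in
/-- The position space Feynman integral in four dimensions of a graph `G` whose vertices are labelled
vertices `l : L`, held fixed at the points `p l`, and internal vertices `v : V`, integrated over `ℝ⁴`
with respect to `d⁴x_v / π²`. The integrand `1 / ∏ Q_e` is nonnegative (with value `∞` where some
quadric vanishes), so that the integral always exists in `[0, ∞]`; it converges, that is, is well
defined as a number, iff it is not `∞`. -/
noncomputable def feynmanIntegral {L V : Type} [Fintype L] [Fintype V]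
    (G : SimpleGraph (L ⊕ V)) (p : L → E4) : ℝ≥0∞ :=
  (ENNReal.ofReal (Real.pi ^ 2))⁻¹ ^ Fintype.card V *
    ∫⁻ x : V → E4, (ENNReal.ofReal (∏ e ∈ G.edgeFinset, quadric (Sum.elim p x) e))⁻¹

/-- The period of a graph with the two labelled vertices `0`, `1`, which are placed at the origin and
at the unit vector `e₁`. -/
noncomputable def period {V : Type} [Fintype V] (G : SimpleGraph (Fin 2 ⊕ V)) (e₁ : E4) : ℝ≥0∞ :=
  feynmanIntegral G ![0, e₁]

/-- The graphical function of a graph with the three labelled vertices `0`, `1`, `z`, here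
`Sum.inl 0`, `Sum.inl 1`, `Sum.inl 2`, which are placed at the origin, at the unit vector `e₁`
and at the argument `z`. -/
noncomputable def graphicalFunction {V : Type} [Fintype V] (G : SimpleGraph (Fin 3 ⊕ V))
    (e₁ z : E4) : ℝ≥0∞ :=
  feynmanIntegral G ![0, e₁, z]

/-- The sequential graph `G_w` of a word `w` in the letters `0, 1, 2`: a horizontal chain with one
vertex for each letter, where the letter `0` stands for an edge to the labelled vertex `0`, the letter
`1` for an edge to the labelled vertex `1`, and the letter `2` for edges to both of them. -/
def sequentialGraph (w : List (Fin 3)) : SimpleGraph (Fin 2 ⊕ Fin w.length) :=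
  SimpleGraph.fromRel fun a b =>
    match a, b with
    | .inl k, .inr i => (k = 0 ∧ (w.get i = 0 ∨ w.get i = 2)) ∨ (k = 1 ∧ (w.get i = 1 ∨ w.get i = 2))
    | .inr i, .inr j => (i : ℕ) + 1 = j
    | _, _ => False

/-- The graph of the sequential function of the word `w`: the sequential graph `G_w` together with a
third labelled vertex `z`, and a horizontal edge from the last vertex of the chain to `z`. -/
def sequentialFunctionGraph (w : List (Fin 3)) : SimpleGraph (Fin 3 ⊕ Fin w.length) :=
  SimpleGraph.fromRel fun a b =>
    match a, b with
    | .inl k, .inr i =>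
        (k = 0 ∧ (w.get i = 0 ∨ w.get i = 2)) ∨ (k = 1 ∧ (w.get i = 1 ∨ w.get i = 2)) ∨
          (k = 2 ∧ (i : ℕ) + 1 = w.length)
    | .inr i, .inr j => (i : ℕ) + 1 = j
    | _, _ => False

/-- The sequential function `f_w` in four dimensions, with values in `[0, ∞]`. -/
noncomputable def sequentialFunction (w : List (Fin 3)) (e₁ z : E4) : ℝ≥0∞ :=
  graphicalFunction (sequentialFunctionGraph w) e₁ z

/-- The sequential period `P(G_w)` in four dimensions, with values in `[0, ∞]`. -/
noncomputable def sequentialPeriod (w : List (Fin 3)) (e₁ : E4) : ℝ≥0∞ :=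
  period (sequentialGraph w) e₁

open MeasureTheory Module Set

/-! By Tonelli the vertices can be integrated out one at a time along the chain, so each letter acts
on nonnegative functions through `appendLetter`.

Convergence: a first letter 2 yields a function bounded by a multiple of ‖y‖⁻¹ + ‖y - e‖⁻¹
(`isMajorized_appendLetter_two`), and every letter preserves this bound
(`IsMajorized.appendLetter`). Indeed, multiplying by a letter weight gives at most a multiple of
‖x‖⁻³ + ‖x - e‖⁻³, and convolution with the propagator turns ‖x‖⁻³ into at most a multiple of ‖y‖⁻¹
(`lintegral_enorm_inv_pow_le`). The bound is finite at z ≠ 0, e, and integrable against the weight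
of a last letter 2.

Divergence is detected at infinity, where ‖x‖⁻⁴ diverges logarithmically. A first vertex with letter
0 or 1 has only two edges, so its integral is infinite wherever its neighbour lies
(`appendLetter_one_eq_top`). In the period the same happens at the last vertex
(`chainIntegral_eq_top_of_last_ne`), and also when there is only one vertex. -/

/-! ### Radial integrals and convolution of powers on ℝ⁴ -/

lemma finrank_E4 : finrank ℝ E4 = 4 := by simp

/-- The function `(1 + ‖x‖)⁻⁴` is not integrable on `ℝ⁴`. -/
lemma lintegral_one_add_enorm_inv_pow_four :
    ∫⁻ x : E4, ((1 + ‖x‖ₑ)⁻¹) ^ 4 = ∞ := by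
  by_contra hne
  have hint : Integrable (fun x : E4 => (fun r : ℝ => ((1 + r)⁻¹) ^ 4) ‖x‖) := by
    refine ⟨by fun_prop, ?_⟩
    rw [HasFiniteIntegral]
    refine lt_of_le_of_lt (le_of_eq ?_) (lt_top_iff_ne_top.2 hne)
    refine lintegral_congr fun x => ?_
    have h0 : 0 < 1 + ‖x‖ := by positivity
    rw [enorm_pow, enorm_inv h0.ne', Real.enorm_of_nonneg h0.le,
      ENNReal.ofReal_add zero_le_one (norm_nonneg x), ofReal_norm, ENNReal.ofReal_one]
  rw [integrable_fun_norm_addHaar volume (f := fun r : ℝ => ((1 + r)⁻¹) ^ 4), finrank_E4] at hint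
  -- For r > 1, 1 + r ≤ 2r gives r⁻¹ ≤ 2⁴ r³ (1 + r)⁻⁴.
  refine not_integrableOn_Ioi_inv (a := 1) ?_
  refine Integrable.mono' ((hint.mono_set (Ioi_subset_Ioi zero_le_one)).const_mul 16)
    (by fun_prop) ((ae_restrict_mem measurableSet_Ioi).mono fun r hr => ?_)
  have hr : (1 : ℝ) < r := hr
  have h0 : 0 < r := by linarith
  rw [Real.norm_of_nonneg (by positivity), smul_eq_mul, inv_pow, ← div_eq_mul_inv, mul_div_assoc',
    inv_eq_one_div, div_le_div_iff₀ h0 (by positivity)]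
  have h : (1 + r) ^ 4 ≤ (2 * r) ^ 4 := by gcongr; linarith
  simp only [show 4 - 1 = 3 from rfl]
  nlinarith

/-- The functions `‖x‖⁻ᵏ` with `k ≤ 3` are integrable on the ball of radius `1 / 2` in `ℝ⁴`. -/
lemma lintegral_ball_enorm_inv_pow_lt_top {k : ℕ} (hk : k ≤ 3) :
    ∫⁻ x in Metric.ball (0 : E4) (1 / 2), (‖x‖ₑ⁻¹) ^ k < ∞ := by
  have hint : IntegrableOn (fun x : E4 => (fun r : ℝ => (r⁻¹) ^ k) ‖x‖)
      (Metric.ball 0 (1 / 2)) := by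
    rw [integrableOn_fun_norm_addHaar volume (f := fun r : ℝ => (r⁻¹) ^ k), finrank_E4]
    refine Integrable.mono' (integrableOn_const (C := (1 : ℝ)) (by simp) (by simp))
      (by fun_prop) ((ae_restrict_mem measurableSet_Ioo).mono fun r hr => ?_)
    obtain ⟨h0, h1⟩ := hr
    rw [smul_eq_mul, Real.norm_of_nonneg (by positivity), inv_pow, ← div_eq_mul_inv,
      div_le_one (by positivity)]
    exact pow_le_pow_of_le_one h0.le (by linarith) hk
  refine lt_of_le_of_lt (le_of_eq ?_) hint.2
  refine lintegral_congr_ae (ae_restrict_of_ae ?_)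
  have h : ∀ᵐ x : E4, x ≠ 0 := by simp [ae_iff]
  filter_upwards [h] with x hx
  rw [enorm_pow, enorm_inv (norm_ne_zero_iff.2 hx), enorm_norm]

/-- The function `‖x‖⁻⁵` is integrable on the complement of a ball in `ℝ⁴`. -/
lemma lintegral_compl_ball_enorm_inv_pow_five_lt_top :
    ∫⁻ x in (Metric.ball (0 : E4) (1 / 2))ᶜ, (‖x‖ₑ⁻¹) ^ 5 < ∞ := by
  have h := finite_integral_one_add_norm (E := E4) (μ := volume) (r := 5)
    (by rw [finrank_E4]; norm_num)
  -- Off the ball 1 + ‖x‖ ≤ 3‖x‖, whence the factor 3⁵.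
  refine lt_of_le_of_lt ?_ (ENNReal.mul_lt_top (a := ENNReal.ofReal (3 ^ 5))
    ENNReal.ofReal_lt_top h)
  rw [← lintegral_const_mul _ (by fun_prop)]
  refine (lintegral_mono_ae ((ae_restrict_mem (by measurability)).mono fun x hx => ?_)).trans
    (setLIntegral_le_lintegral _ _)
  have hx : 1 / 2 ≤ ‖x‖ := by simpa using hx
  have h0 : 0 < ‖x‖ := by linarith
  rw [← ofReal_norm, ← ENNReal.ofReal_inv_of_pos h0, ← ENNReal.ofReal_pow (by positivity),
    ← ENNReal.ofReal_mul (by positivity)]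
  refine ENNReal.ofReal_le_ofReal ?_
  rw [Real.rpow_neg (by positivity), show (5 : ℝ) = (5 : ℕ) by norm_num, Real.rpow_natCast, inv_pow,
    ← div_eq_mul_inv, inv_eq_one_div, div_le_div_iff₀ (by positivity) (by positivity), one_mul,
    ← mul_pow]
  gcongr
  linarith

lemma ENNReal.pow_mul_pow_le_add (a b : ℝ≥0∞) (m n : ℕ) :
    a ^ m * b ^ n ≤ a ^ (m + n) + b ^ (m + n) := by
  rcases le_total a b with h | h
  · calc a ^ m * b ^ n ≤ b ^ m * b ^ n := by gcongr
      _ = b ^ (m + n) := (pow_add ..).symm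
      _ ≤ _ := le_add_self
  · calc a ^ m * b ^ n ≤ a ^ m * a ^ n := by gcongr
      _ = a ^ (m + n) := (pow_add ..).symm
      _ ≤ _ := le_self_add

lemma enorm_inv_le_two {u : E4} (hu : 1 / 2 ≤ ‖u‖) : ‖u‖ₑ⁻¹ ≤ 2 := by
  rw [ENNReal.inv_le_iff_inv_le, ← ofReal_norm]
  refine le_trans (le_of_eq ?_) (ENNReal.ofReal_le_ofReal hu)
  rw [one_div, ENNReal.ofReal_inv_of_pos two_pos]; simp

/-- The singularities 0 and y have distance 1. Within 1/2 of one of them the other factor is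
bounded; away from both, the product is at most a sum of fifth powers, integrable since 5 > 4.
Translation invariance makes the constant independent of y. -/
lemma lintegral_enorm_inv_pow_unit_le : ∃ C : ℝ≥0∞, C < ∞ ∧ ∀ y : E4, ‖y‖ = 1 →
    ∫⁻ x : E4, (‖x‖ₑ⁻¹) ^ 3 * (‖x - y‖ₑ⁻¹) ^ 2 ≤ C := by
  set B : Set E4 := Metric.ball 0 (1 / 2) with hB
  have hBm : MeasurableSet B := measurableSet_ball
  let f : ℕ → E4 → ℝ≥0∞ := fun k => B.indicator fun x => (‖x‖ₑ⁻¹) ^ k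
  let g : E4 → ℝ≥0∞ := Bᶜ.indicator fun x => (‖x‖ₑ⁻¹) ^ 5
  have hfm : ∀ k, Measurable (f k) := fun k => Measurable.indicator (by fun_prop) hBm
  have hgm : Measurable g := Measurable.indicator (by fun_prop) hBm.compl
  refine ⟨4 * (∫⁻ x, f 3 x) + 8 * (∫⁻ x, f 2 x) + ((∫⁻ x, g x) + ∫⁻ x, g x), ?_, fun y hy => ?_⟩
  · simp only [f, g, lintegral_indicator hBm, lintegral_indicator hBm.compl]
    have h3 := lintegral_ball_enorm_inv_pow_lt_top (le_refl 3)
    have h2 := lintegral_ball_enorm_inv_pow_lt_top (show 2 ≤ 3 by norm_num)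
    have h5 := lintegral_compl_ball_enorm_inv_pow_five_lt_top
    rw [← hB] at h2 h3 h5
    simp only [ENNReal.add_lt_top]
    exact ⟨⟨ENNReal.mul_lt_top (by simp) h3, ENNReal.mul_lt_top (by simp) h2⟩, h5, h5⟩
  · have key : ∀ x : E4, (‖x‖ₑ⁻¹) ^ 3 * (‖x - y‖ₑ⁻¹) ^ 2 ≤
        4 * f 3 x + 8 * f 2 (x - y) + (g x + g (x - y)) := fun x => by
      by_cases hx : x ∈ B
      · have h1 : ‖x‖ < 1 / 2 := by simpa [hB] using hx
        have h2 : 1 / 2 ≤ ‖x - y‖ := by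
          have := norm_sub_norm_le y x
          rw [norm_sub_rev y x] at this; linarith
        have : (‖x‖ₑ⁻¹) ^ 3 * (‖x - y‖ₑ⁻¹) ^ 2 ≤ 4 * f 3 x := by
          simp only [f, indicator_of_mem hx]
          calc _ ≤ (‖x‖ₑ⁻¹) ^ 3 * 2 ^ 2 := by gcongr; exact enorm_inv_le_two h2
            _ = _ := by rw [mul_comm]; norm_num
        exact this.trans (le_add_right (le_add_right le_rfl))
      by_cases hxy : x - y ∈ B
      · have h1 : ‖x - y‖ < 1 / 2 := by simpa [hB] using hxy
        have h2 : 1 / 2 ≤ ‖x‖ := by simpa [hB] using hx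
        have : (‖x‖ₑ⁻¹) ^ 3 * (‖x - y‖ₑ⁻¹) ^ 2 ≤ 8 * f 2 (x - y) := by
          simp only [f, indicator_of_mem hxy]
          calc _ ≤ 2 ^ 3 * (‖x - y‖ₑ⁻¹) ^ 2 := by gcongr; exact enorm_inv_le_two h2
            _ = _ := by norm_num
        exact this.trans (le_add_right (le_add_left le_rfl))
      · have : (‖x‖ₑ⁻¹) ^ 3 * (‖x - y‖ₑ⁻¹) ^ 2 ≤ g x + g (x - y) := by
          simp only [g, indicator_of_mem (mem_compl hx), indicator_of_mem (mem_compl hxy)]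
          exact ENNReal.pow_mul_pow_le_add _ _ 3 2
        exact this.trans (le_add_left le_rfl)
    refine (lintegral_mono key).trans (le_of_eq ?_)
    have hsub : Measurable fun x : E4 => x - y := by fun_prop
    rw [lintegral_add_left (by have := hfm 3; have := (hfm 2).comp hsub; fun_prop),
      lintegral_add_left (by have := hfm 3; fun_prop),
      lintegral_add_left hgm, lintegral_const_mul _ (hfm 3),
      lintegral_const_mul _ (show Measurable fun x => f 2 (x - y) from (hfm 2).comp hsub),
      lintegral_sub_right_eq_self (f 2) y, lintegral_sub_right_eq_self g y]

/-- Convolution of `‖x‖⁻³` with `‖x‖⁻²` on `ℝ⁴` is bounded by a multiple of `‖y‖⁻¹`. -/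
lemma lintegral_enorm_inv_pow_le : ∃ C : ℝ≥0∞, C < ∞ ∧ ∀ y : E4,
    ∫⁻ x : E4, (‖x‖ₑ⁻¹) ^ 3 * (‖x - y‖ₑ⁻¹) ^ 2 ≤ C * ‖y‖ₑ⁻¹ := by
  obtain ⟨C, hC, h⟩ := lintegral_enorm_inv_pow_unit_le
  -- The constant must be nonzero so that the right side is ∞ at y = 0.
  refine ⟨C + 1, by simp [hC], fun y => ?_⟩
  rcases eq_or_ne y 0 with rfl | hy
  · simp
  have hr : ‖y‖ ≠ 0 := norm_ne_zero_iff.2 hy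
  set r := ‖y‖ with hrdef
  have hr0 : 0 < r := (norm_nonneg y).lt_of_ne' hr
  have hu : ‖r⁻¹ • y‖ = 1 := by
    rw [norm_smul, Real.norm_of_nonneg (by positivity), ← hrdef, inv_mul_cancel₀ hr]
  have hmap := Measure.map_addHaar_smul (volume : Measure E4) hr
  have hvol : (volume : Measure E4) =
      ENNReal.ofReal (r ^ 4) • Measure.map (r • ·) (volume : Measure E4) := by
    rw [hmap, smul_smul, finrank_E4, abs_of_pos (by positivity), ← ENNReal.ofReal_mul (by positivity),
      mul_inv_cancel₀ (by positivity), ENNReal.ofReal_one, one_smul]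
  have hye : ‖y‖ₑ = ENNReal.ofReal r := (ofReal_norm y).symm
  have hE0 : ENNReal.ofReal r ≠ 0 := by simpa using hr0
  have hEt : ENNReal.ofReal r ≠ ∞ := ENNReal.ofReal_ne_top
  have hsm : ∀ u : E4, ‖r • u‖ₑ⁻¹ = (ENNReal.ofReal r)⁻¹ * ‖u‖ₑ⁻¹ := fun u => by
    rw [enorm_smul, Real.enorm_of_nonneg hr0.le, ENNReal.mul_inv (Or.inl hE0) (Or.inl hEt)]
  -- Substituting x ↦ r x gives r⁴ from the measure and r⁻⁵ from the integrand, in total r⁻¹.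
  calc ∫⁻ x : E4, (‖x‖ₑ⁻¹) ^ 3 * (‖x - y‖ₑ⁻¹) ^ 2
      = ENNReal.ofReal (r ^ 4) * ∫⁻ x : E4, (‖r • x‖ₑ⁻¹) ^ 3 * (‖r • x - y‖ₑ⁻¹) ^ 2 := by
        conv_lhs => rw [hvol]
        rw [lintegral_smul_measure, lintegral_map (by fun_prop) (by fun_prop), smul_eq_mul]
    _ = ENNReal.ofReal (r ^ 4) * ∫⁻ x : E4, (ENNReal.ofReal r)⁻¹ ^ 5 *
          ((‖x‖ₑ⁻¹) ^ 3 * (‖x - r⁻¹ • y‖ₑ⁻¹) ^ 2) := by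
        congr 1
        refine lintegral_congr fun x => ?_
        rw [show r • x - y = r • (x - r⁻¹ • y) by rw [smul_sub, smul_inv_smul₀ hr], hsm, hsm]
        ring
    _ = (ENNReal.ofReal r)⁻¹ * ∫⁻ x : E4, (‖x‖ₑ⁻¹) ^ 3 * (‖x - r⁻¹ • y‖ₑ⁻¹) ^ 2 := by
        rw [lintegral_const_mul _ (by fun_prop), ← mul_assoc, ENNReal.ofReal_pow hr0.le, pow_succ _ 4,
          ← mul_assoc, ← mul_pow, ENNReal.mul_inv_cancel hE0 hEt, one_pow, one_mul]
    _ ≤ (ENNReal.ofReal r)⁻¹ * C := by gcongr; exact h _ hu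
    _ ≤ (C + 1) * ‖y‖ₑ⁻¹ := by rw [hye, mul_comm]; gcongr; exact le_self_add

/-! ### From Feynman integrals to chain integrals -/

/-- A product over the edges of the graph of an asymmetric relation is a product over the related
pairs. -/
lemma SimpleGraph.prod_edgeFinset_fromRel {α M : Type*} [Fintype α] [CommMonoid M]
    (r : α → α → Prop) [DecidableRel r] (hr : ∀ a b, r a b → ¬ r b a)
    [Fintype (SimpleGraph.fromRel r).edgeSet] (f : Sym2 α → M) :
    ∏ e ∈ (SimpleGraph.fromRel r).edgeFinset, f e = ∏ a, ∏ b, if r a b then f s(a, b) else 1 := by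
  rw [← Fintype.prod_prod_type' (fun a b => if r a b then f s(a, b) else 1), ← Finset.prod_filter]
  symm
  refine Finset.prod_nbij (fun p => s(p.1, p.2)) ?_ ?_ ?_ (fun _ _ => rfl)
  · rintro ⟨a, b⟩ h
    have h : r a b := by simpa using h
    rw [SimpleGraph.mem_edgeFinset, SimpleGraph.mem_edgeSet, SimpleGraph.fromRel_adj]
    exact ⟨fun hab : a = b => hr a b h (by subst hab; exact h), Or.inl h⟩
  · rintro ⟨a, b⟩ h ⟨c, d⟩ h' heq
    have h : r a b := by simpa using h
    have h' : r c d := by simpa using h'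
    rcases Sym2.eq_iff.1 heq with ⟨h1, h2⟩ | ⟨h1, h2⟩
    · exact Prod.ext h1 h2
    · dsimp only at h1 h2
      subst h1 h2
      exact absurd h' (hr _ _ h)
  · intro e he
    induction e with
    | _ a b =>
      rw [Finset.mem_coe, SimpleGraph.mem_edgeFinset, SimpleGraph.mem_edgeSet,
        SimpleGraph.fromRel_adj] at he
      rcases he.2 with h | h
      · exact ⟨(a, b), by simpa using h, rfl⟩
      · exact ⟨(b, a), by simpa using h, Sym2.eq_swap⟩

lemma ENNReal.inv_prod {ι : Type*} (s : Finset ι) (f : ι → ℝ≥0∞) (hf : ∀ i ∈ s, f i ≠ ∞) :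
    (∏ i ∈ s, f i)⁻¹ = ∏ i ∈ s, (f i)⁻¹ :=
  ENNReal.prod_inv_distrib fun _ _ j hj _ => Or.inr (hf j hj)

/-- The propagator between the points `x` and `y` of `ℝ⁴`. -/
noncomputable def propagator (x y : E4) : ℝ≥0∞ := (‖x - y‖ₑ⁻¹) ^ 2

lemma propagator_comm (x y : E4) : propagator x y = propagator y x := by
  rw [propagator, propagator, enorm_sub_rev]

@[fun_prop]
lemma Measurable.propagator {α : Type*} [MeasurableSpace α] {f g : α → E4} (hf : Measurable f)
    (hg : Measurable g) : Measurable fun x => propagator (f x) (g x) := by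
  unfold _root_.propagator; fun_prop

lemma inv_ofReal_quadric {α : Type} (y : α → E4) (a b : α) :
    (ENNReal.ofReal (quadric y s(a, b)))⁻¹ = propagator (y a) (y b) := by
  simp only [quadric, Sym2.lift_mk, propagator]
  rw [ENNReal.ofReal_pow (norm_nonneg _), ofReal_norm, ENNReal.inv_pow]

lemma quadric_nonneg {α : Type} (y : α → E4) (e : Sym2 α) : 0 ≤ quadric y e := by
  induction e with
  | _ a b => simp only [quadric, Sym2.lift_mk]; positivity

open scoped Classical in
lemma inv_ofReal_prod_quadric_fromRel {α : Type} [Fintype α] (r : α → α → Prop)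
    (hr : ∀ a b, r a b → ¬ r b a) [Fintype (SimpleGraph.fromRel r).edgeSet] (y : α → E4) :
    (ENNReal.ofReal (∏ e ∈ (SimpleGraph.fromRel r).edgeFinset, quadric y e))⁻¹ =
      ∏ a, ∏ b, if r a b then propagator (y a) (y b) else 1 := by
  rw [ENNReal.ofReal_prod_of_nonneg fun e _ => quadric_nonneg y e,
    ENNReal.inv_prod _ _ fun _ _ => ENNReal.ofReal_ne_top, SimpleGraph.prod_edgeFinset_fromRel r hr]
  simp only [inv_ofReal_quadric]

/-- The product of the propagators from the point `x` to the labelled vertices that are adjacent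
to a vertex with letter `a`. -/
noncomputable def letterWeight (e : E4) (a : Fin 3) (x : E4) : ℝ≥0∞ :=
  (if a = 0 ∨ a = 2 then propagator x 0 else 1) * (if a = 1 ∨ a = 2 then propagator x e else 1)

lemma Fin.prod_prod_ite_val_succ_eq {M : Type*} [CommMonoid M] {n : ℕ}
    (f : Fin (n + 1) → Fin (n + 1) → M) :
    (∏ i : Fin (n + 1), ∏ j : Fin (n + 1), if (i : ℕ) + 1 = j then f i j else 1) =
      ∏ i : Fin n, f i.castSucc i.succ := by
  rw [Fin.prod_univ_castSucc, Fintype.prod_eq_one (fun j : Fin (n + 1) =>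
    if ((Fin.last n : Fin (n + 1)) : ℕ) + 1 = j then f (Fin.last n) j else 1), mul_one]
  · refine Finset.prod_congr rfl fun i _ => ?_
    rw [Finset.prod_eq_single i.succ]
    · simp
    · intro j _ hj
      rw [if_neg]
      contrapose! hj
      ext
      simpa using hj.symm
    · simp
  · intro j
    rw [if_neg]
    simp only [Fin.val_last]
    omega

/-- The integral over a chain of `n + 1` vertices with letters `a`, where the function `g` is
attached to the first vertex and the function `h` to the last one. -/
noncomputable def chainIntegral (e : E4) {n : ℕ} (a : Fin (n + 1) → Fin 3) (g h : E4 → ℝ≥0∞) :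
    ℝ≥0∞ :=
  ∫⁻ x : Fin (n + 1) → E4, g (x 0) * ((∏ i, letterWeight e (a i) (x i)) *
    ∏ i : Fin n, propagator (x i.castSucc) (x i.succ)) * h (x (Fin.last n))

lemma mul_lt_top_iff_of_const {c s : ℝ≥0∞} (h0 : c ≠ 0) (ht : c ≠ ∞) : c * s < ∞ ↔ s < ∞ := by
  simp [ENNReal.mul_lt_top_iff, h0, ht.lt_top]
  rintro rfl; simp

lemma inv_pi_sq_pow_ne (n : ℕ) : (ENNReal.ofReal (Real.pi ^ 2))⁻¹ ^ n ≠ 0 ∧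
    (ENNReal.ofReal (Real.pi ^ 2))⁻¹ ^ n ≠ ∞ :=
  ⟨pow_ne_zero _ (by simp), ENNReal.pow_ne_top (by simp [Real.pi_ne_zero])⟩

lemma sequentialPeriod_lt_top_iff (e : E4) (a : Fin 3) (l : List (Fin 3)) :
    sequentialPeriod (a :: l) e < ∞ ↔ chainIntegral e (a :: l).get 1 1 < ∞ := by
  rw [sequentialPeriod, period, feynmanIntegral,
    mul_lt_top_iff_of_const (inv_pi_sq_pow_ne _).1 (inv_pi_sq_pow_ne _).2, chainIntegral]
  refine iff_of_eq (congrArg (· < ∞) (lintegral_congr fun x => ?_))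
  rw [sequentialGraph, inv_ofReal_prod_quadric_fromRel]
  · simp only [Fintype.prod_sum_type, Sum.elim_inl, Sum.elim_inr, if_false, Finset.prod_const_one,
      one_mul, Fin.prod_univ_two, Pi.one_apply, mul_one]
    rw [← Finset.prod_mul_distrib]
    refine congrArg₂ _ (Finset.prod_congr rfl fun i _ => ?_) (Eq.trans (Finset.prod_congr rfl
      fun i _ => Finset.prod_congr rfl fun j _ => by congr)
        (Fin.prod_prod_ite_val_succ_eq fun i j => propagator (x i) (x j)))
    simp [letterWeight, propagator_comm]
  · rintro (i | i) (j | j) h h'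
    · exact h
    · exact h'
    · exact h
    · dsimp only at h h'
      omega

lemma sequentialFunction_lt_top_iff (e z : E4) (a : Fin 3) (l : List (Fin 3)) :
    sequentialFunction (a :: l) e z < ∞ ↔
      chainIntegral e (a :: l).get 1 (propagator z) < ∞ := by
  rw [sequentialFunction, graphicalFunction, feynmanIntegral,
    mul_lt_top_iff_of_const (inv_pi_sq_pow_ne _).1 (inv_pi_sq_pow_ne _).2, chainIntegral]
  refine iff_of_eq (congrArg (· < ∞) (lintegral_congr fun x => ?_))
  rw [sequentialFunctionGraph, inv_ofReal_prod_quadric_fromRel]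
  · simp only [Fintype.prod_sum_type, Sum.elim_inl, Sum.elim_inr, if_false, Finset.prod_const_one,
      one_mul, Fin.prod_univ_three, Pi.one_apply]
    rw [mul_right_comm, ← Finset.prod_mul_distrib]
    refine congrArg₂ _ ?_ ((Finset.prod_eq_single (Fin.last l.length) ?_ ?_).trans ?_)
    · refine congrArg₂ _ (Finset.prod_congr rfl fun i _ => ?_) (Eq.trans (Finset.prod_congr rfl
        fun i _ => Finset.prod_congr rfl fun j _ => by congr)
          (Fin.prod_prod_ite_val_succ_eq fun i j => propagator (x i) (x j)))
      simp [letterWeight, propagator_comm]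
    · intro j _ hj
      rw [if_neg]
      contrapose! hj
      ext
      simpa using hj
    · exact fun h => absurd (Finset.mem_univ _) h
    · simp
  · rintro (i | i) (j | j) h h'
    · exact h
    · exact h'
    · exact h
    · dsimp only at h h'
      omega

/-! ### Integrating out one vertex at a time -/

/-- Integration over a vertex with letter `a` which carries the function `g`. -/
noncomputable def appendLetter (e : E4) (a : Fin 3) (g : E4 → ℝ≥0∞) (y : E4) : ℝ≥0∞ :=
  ∫⁻ x, g x * letterWeight e a x * propagator x y

@[fun_prop]
lemma measurable_letterWeight (e : E4) (a : Fin 3) : Measurable (letterWeight e a) := by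
  unfold letterWeight
  split_ifs <;> fun_prop

lemma measurable_appendLetter (e : E4) (a : Fin 3) {g : E4 → ℝ≥0∞} (hg : Measurable g) :
    Measurable (appendLetter e a g) := by
  unfold appendLetter
  refine Measurable.lintegral_prod_left' (f := fun p : E4 × E4 =>
    g p.1 * letterWeight e a p.1 * propagator p.1 p.2) ?_
  fun_prop

lemma chainIntegral_zero (e : E4) (a : Fin 1 → Fin 3) (g h : E4 → ℝ≥0∞) :
    chainIntegral e a g h = ∫⁻ x, g x * letterWeight e (a 0) x * h x := by
  have := (volume_preserving_funUnique (Fin 1) E4).lintegral_comp_emb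
    (MeasurableEquiv.measurableEmbedding _) (fun x => g x * letterWeight e (a 0) x * h x)
  rw [← this, chainIntegral]
  refine lintegral_congr fun x => ?_
  simp [MeasurableEquiv.funUnique]

/-- Tonelli: the first vertex is integrated out, and its propagator to the second vertex is absorbed
into the new attached function. -/
lemma chainIntegral_succ (e : E4) {n : ℕ} (a : Fin (n + 2) → Fin 3) {g h : E4 → ℝ≥0∞}
    (hg : Measurable g) (hh : Measurable h) :
    chainIntegral e a g h = chainIntegral e (fun i => a i.succ) (appendLetter e (a 0) g) h := by
  have hmp := (volume_preserving_piFinSuccAbove (fun _ : Fin (n + 2) => E4) 0).symm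
  rw [chainIntegral, ← hmp.lintegral_comp_emb (MeasurableEquiv.measurableEmbedding _),
    Measure.volume_eq_prod, lintegral_prod_symm _ (by fun_prop), chainIntegral]
  refine lintegral_congr fun x => ?_
  rw [appendLetter, mul_assoc, ← lintegral_mul_const _ (by fun_prop)]
  refine lintegral_congr fun y => ?_
  simp only [MeasurableEquiv.piFinSuccAbove_symm_apply, Fin.insertNthEquiv_zero, Fin.consEquiv_apply]
  have hp : ∏ i : Fin (n + 1), propagator ((Fin.cons y x : Fin (n + 2) → E4) i.castSucc)
      ((Fin.cons y x : Fin (n + 2) → E4) i.succ) =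
        propagator y (x 0) * ∏ i : Fin n, propagator (x i.castSucc) (x i.succ) := by
    rw [Fin.prod_univ_succ]
    simp
  rw [hp, Fin.prod_univ_succ, ← Fin.succ_last]
  simp only [Fin.cons_zero, Fin.cons_succ]
  ring

lemma letterWeight_zero (e x : E4) : letterWeight e 0 x = (‖x‖ₑ⁻¹) ^ 2 := by
  simp [letterWeight, propagator]

lemma letterWeight_one (e x : E4) : letterWeight e 1 x = (‖x - e‖ₑ⁻¹) ^ 2 := by
  simp [letterWeight, propagator]

lemma letterWeight_two (e x : E4) :
    letterWeight e 2 x = (‖x‖ₑ⁻¹) ^ 2 * (‖x - e‖ₑ⁻¹) ^ 2 := by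
  simp [letterWeight, propagator]

/-! ### Upper bounds and convergence -/

/-- A function that dominates the sequential functions up to constants. -/
noncomputable def majorant (e : E4) (k : ℕ) (x : E4) : ℝ≥0∞ := (‖x‖ₑ⁻¹) ^ k + (‖x - e‖ₑ⁻¹) ^ k

@[fun_prop]
lemma measurable_majorant (e : E4) (k : ℕ) : Measurable (majorant e k) := by
  unfold majorant; fun_prop

lemma enorm_inv_le_two_or {e : E4} (he : ‖e‖ = 1) (x : E4) :
    ‖x‖ₑ⁻¹ ≤ 2 ∨ ‖x - e‖ₑ⁻¹ ≤ 2 := by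
  rcases le_total (1 / 2) ‖x‖ with h | h
  · exact Or.inl (enorm_inv_le_two h)
  · refine Or.inr (enorm_inv_le_two ?_)
    have := norm_sub_norm_le e x
    rw [norm_sub_rev e x] at this
    linarith

/-- One of the two inverse distances is at most 2; peeling off one copy of it leaves a mixed
monomial of degree 3. -/
lemma letterWeight_two_le {e : E4} (he : ‖e‖ = 1) (x : E4) :
    letterWeight e 2 x ≤ 2 * majorant e 3 x := by
  rw [letterWeight_two, majorant]
  rcases enorm_inv_le_two_or he x with h | h
  · calc _ = ‖x‖ₑ⁻¹ * (‖x‖ₑ⁻¹ ^ 1 * ‖x - e‖ₑ⁻¹ ^ 2) := by ring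
      _ ≤ 2 * (‖x‖ₑ⁻¹ ^ 3 + ‖x - e‖ₑ⁻¹ ^ 3) :=
        mul_le_mul' h (ENNReal.pow_mul_pow_le_add _ _ 1 2)
  · calc _ = ‖x - e‖ₑ⁻¹ * (‖x‖ₑ⁻¹ ^ 2 * ‖x - e‖ₑ⁻¹ ^ 1) := by ring
      _ ≤ 2 * (‖x‖ₑ⁻¹ ^ 3 + ‖x - e‖ₑ⁻¹ ^ 3) :=
        mul_le_mul' h (ENNReal.pow_mul_pow_le_add _ _ 2 1)

lemma letterWeight_le_majorant {e : E4} (he : ‖e‖ = 1) (a : Fin 3) (x : E4) :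
    letterWeight e a x ≤ 4 * majorant e 2 x := by
  rw [majorant]
  have h1 : ∀ u : ℝ≥0∞, u ≤ 4 * u := fun u => le_mul_of_one_le_left' (by norm_num)
  fin_cases a
  · exact (letterWeight_zero e x).trans_le ((h1 _).trans (by gcongr; exact le_self_add))
  · exact (letterWeight_one e x).trans_le ((h1 _).trans (by gcongr; exact le_add_self))
  · refine (letterWeight_two e x).trans_le ?_
    have h4 : (2 : ℝ≥0∞) ^ 2 = 4 := by norm_num
    rcases enorm_inv_le_two_or he x with h | h
    · calc _ ≤ 2 ^ 2 * ‖x - e‖ₑ⁻¹ ^ 2 := by gcongr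
        _ ≤ _ := by rw [h4]; gcongr; exact le_add_self
    · calc _ ≤ ‖x‖ₑ⁻¹ ^ 2 * 2 ^ 2 := by gcongr
        _ ≤ _ := by rw [h4, mul_comm]; gcongr; exact le_self_add

lemma majorant_mul_letterWeight_le {e : E4} (he : ‖e‖ = 1) (a : Fin 3) (x : E4) :
    majorant e 1 x * letterWeight e a x ≤ 12 * majorant e 3 x := by
  refine (mul_le_mul_right (letterWeight_le_majorant he a x) _).trans ?_
  simp only [majorant]
  set p := ‖x‖ₑ⁻¹
  set q := ‖x - e‖ₑ⁻¹
  calc (p ^ 1 + q ^ 1) * (4 * (p ^ 2 + q ^ 2))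
      = 4 * (p ^ 3 + q ^ 3) + 4 * (p ^ 1 * q ^ 2) + 4 * (p ^ 2 * q ^ 1) := by ring
    _ ≤ 4 * (p ^ 3 + q ^ 3) + 4 * (p ^ (1 + 2) + q ^ (1 + 2)) +
        4 * (p ^ (2 + 1) + q ^ (2 + 1)) := by
        gcongr <;> exact ENNReal.pow_mul_pow_le_add _ _ _ _
    -- 12 = 4 + 4 + 4: the pure cubes and the two mixed terms contribute equally.
    _ = _ := by norm_num; ring

lemma lintegral_enorm_sub_inv_pow_le : ∃ C : ℝ≥0∞, C < ∞ ∧ ∀ e y : E4,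
    ∫⁻ x : E4, (‖x - e‖ₑ⁻¹) ^ 3 * (‖x - y‖ₑ⁻¹) ^ 2 ≤ C * ‖y - e‖ₑ⁻¹ := by
  obtain ⟨C, hC, h⟩ := lintegral_enorm_inv_pow_le
  refine ⟨C, hC, fun e y => (le_of_eq ?_).trans (h (y - e))⟩
  simpa only [sub_sub_sub_cancel_right] using
    lintegral_sub_right_eq_self (fun x => (‖x‖ₑ⁻¹) ^ 3 * (‖x - (y - e)‖ₑ⁻¹) ^ 2) e

lemma lintegral_majorant_mul_propagator_le (e : E4) : ∃ C : ℝ≥0∞, C < ∞ ∧ ∀ y : E4,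
    ∫⁻ x : E4, majorant e 3 x * propagator x y ≤ C * majorant e 1 y := by
  obtain ⟨C, hC, h⟩ := lintegral_enorm_sub_inv_pow_le
  refine ⟨C, hC, fun y => ?_⟩
  simp only [majorant, propagator, add_mul, pow_one]
  rw [lintegral_add_left (by fun_prop), mul_add]
  exact add_le_add (by simpa using h 0 y) (h e y)

/-- The integrand expands into the two convolution integrands centred at 0 and e, each evaluated at
the other point, at distance 1. -/
lemma lintegral_majorant_mul_letterWeight_two_lt_top {e : E4} (he : ‖e‖ = 1) :
    ∫⁻ x : E4, majorant e 1 x * letterWeight e 2 x < ∞ := by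
  obtain ⟨C, hC, h⟩ := lintegral_enorm_sub_inv_pow_le
  have he' : ‖e‖ₑ = 1 := by rw [← ofReal_norm, he, ENNReal.ofReal_one]
  calc ∫⁻ x : E4, majorant e 1 x * letterWeight e 2 x
      = ∫⁻ x : E4, (‖x - 0‖ₑ⁻¹ ^ 3 * ‖x - e‖ₑ⁻¹ ^ 2 + ‖x - e‖ₑ⁻¹ ^ 3 * ‖x - 0‖ₑ⁻¹ ^ 2) := by
        refine lintegral_congr fun x => ?_
        rw [majorant, letterWeight_two, sub_zero]
        ring
    _ ≤ C * ‖e - 0‖ₑ⁻¹ + C * ‖0 - e‖ₑ⁻¹ := by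
        rw [lintegral_add_left (by fun_prop)]
        exact add_le_add (h 0 e) (h e 0)
    _ < ∞ := by simp [he', hC]

/-- The function is bounded by a multiple of the majorant. -/
def IsMajorized (e : E4) (g : E4 → ℝ≥0∞) : Prop :=
  ∃ C : ℝ≥0∞, C < ∞ ∧ ∀ y, g y ≤ C * majorant e 1 y

lemma isMajorized_appendLetter_of_le {e : E4} {a : Fin 3} {g : E4 → ℝ≥0∞} {C : ℝ≥0∞} (hC : C < ∞)
    (h : ∀ x, g x * letterWeight e a x ≤ C * majorant e 3 x) :
    IsMajorized e (appendLetter e a g) := by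
  obtain ⟨D, hD, hle⟩ := lintegral_majorant_mul_propagator_le e
  refine ⟨C * D, ENNReal.mul_lt_top hC hD, fun y => ?_⟩
  calc appendLetter e a g y ≤ ∫⁻ x, C * (majorant e 3 x * propagator x y) :=
        lintegral_mono fun x => by rw [← mul_assoc]; exact mul_le_mul' (h x) le_rfl
    _ = C * ∫⁻ x, majorant e 3 x * propagator x y := lintegral_const_mul _ (by fun_prop)
    _ ≤ C * (D * majorant e 1 y) := by gcongr; exact hle y
    _ = _ := (mul_assoc ..).symm

lemma isMajorized_appendLetter_two {e : E4} (he : ‖e‖ = 1) :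
    IsMajorized e (appendLetter e 2 1) :=
  isMajorized_appendLetter_of_le (C := 2) (by simp) fun x => by
    simpa using letterWeight_two_le he x

lemma IsMajorized.mul_letterWeight_le {e : E4} (he : ‖e‖ = 1) {g : E4 → ℝ≥0∞}
    (hg : IsMajorized e g) (a : Fin 3) :
    ∃ C : ℝ≥0∞, C < ∞ ∧ ∀ x, g x * letterWeight e a x ≤ C * majorant e 3 x := by
  obtain ⟨C, hC, h⟩ := hg
  refine ⟨C * 12, ENNReal.mul_lt_top hC (by simp), fun x => ?_⟩
  calc g x * letterWeight e a x ≤ C * majorant e 1 x * letterWeight e a x := by gcongr; exact h x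
    _ ≤ C * (12 * majorant e 3 x) := by
      rw [mul_assoc]; exact mul_le_mul' le_rfl (majorant_mul_letterWeight_le he a x)
    _ = _ := (mul_assoc ..).symm

lemma IsMajorized.appendLetter {e : E4} (he : ‖e‖ = 1) {g : E4 → ℝ≥0∞}
    (hg : IsMajorized e g) (a : Fin 3) : IsMajorized e (appendLetter e a g) := by
  obtain ⟨C, hC, h⟩ := hg.mul_letterWeight_le he a
  exact isMajorized_appendLetter_of_le hC h

/-- Majorization survives every integration, so only the integral over the last vertex has to be
controlled. -/
lemma chainIntegral_lt_top {e : E4} (he : ‖e‖ = 1) {n : ℕ} (a : Fin (n + 1) → Fin 3)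
    {g h : E4 → ℝ≥0∞} (hg : Measurable g) (hh : Measurable h) (hgm : IsMajorized e g)
    (hfin : ∫⁻ x, majorant e 1 x * letterWeight e (a (Fin.last n)) x * h x < ∞) :
    chainIntegral e a g h < ∞ := by
  induction n generalizing g with
  | zero =>
    obtain ⟨C, hC, hle⟩ := hgm
    rw [chainIntegral_zero]
    refine lt_of_le_of_lt ?_ (ENNReal.mul_lt_top hC hfin)
    rw [← lintegral_const_mul _ (by fun_prop)]
    refine lintegral_mono fun x => ?_
    rw [← mul_assoc, ← mul_assoc]
    exact mul_le_mul_left (mul_le_mul_left (hle x) _) _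
  | succ n ih =>
    rw [chainIntegral_succ e a hg hh]
    exact ih (fun i => a i.succ) (measurable_appendLetter e _ hg) (hgm.appendLetter he _) hfin

/-! ### Lower bounds and divergence -/

/-- The function `(1 + ‖x‖)⁻²`. -/
noncomputable def minorant (x : E4) : ℝ≥0∞ := ((1 + ‖x‖ₑ)⁻¹) ^ 2

@[fun_prop]
lemma measurable_minorant : Measurable minorant := by unfold minorant; fun_prop

lemma minorant_ne_zero (x : E4) : minorant x ≠ 0 := by simp [minorant]

/-- This is ‖x - y‖ ≤ (1 + ‖x‖)(1 + ‖y‖), which separates the variables. -/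
lemma minorant_mul_le_propagator (x y : E4) : minorant y * minorant x ≤ propagator x y := by
  rw [minorant, minorant, propagator, ← mul_pow,
    ← ENNReal.mul_inv (Or.inl (by simp)) (Or.inl (by simp))]
  gcongr
  calc ‖x - y‖ₑ ≤ ‖x‖ₑ + ‖y‖ₑ := enorm_sub_le
    _ ≤ (1 + ‖x‖ₑ + ‖y‖ₑ) + ‖y‖ₑ * ‖x‖ₑ := by
      rw [add_assoc 1]; exact le_add_right le_add_self
    _ = _ := by ring

lemma lintegral_minorant_sq : ∫⁻ x, minorant x * minorant x = ∞ := by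
  rw [← lintegral_one_add_enorm_inv_pow_four]
  refine lintegral_congr fun x => ?_
  rw [minorant]; ring

lemma minorant_le_letterWeight (e : E4) {a : Fin 3} (ha : a ≠ 2) (x : E4) :
    minorant e * minorant x ≤ letterWeight e a x := by
  have h1 : ∀ u, minorant u ≤ 1 := fun u => by
    rw [minorant]; exact pow_le_one' (ENNReal.inv_le_one.2 le_self_add) _
  have h0 := minorant_mul_le_propagator x 0
  have he := minorant_mul_le_propagator x e
  simp only [minorant, propagator, enorm_zero, sub_zero, add_zero, inv_one, one_pow, one_mul] at h0
  fin_cases a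
  · refine le_of_le_of_eq ?_ (letterWeight_zero e x).symm
    exact (mul_le_of_le_one_left' (h1 e)).trans h0
  · exact he.trans_eq (letterWeight_one e x).symm
  · exact absurd rfl ha

lemma minorant_mul_le_letterWeight (e : E4) (a : Fin 3) (x : E4) :
    minorant e * (minorant x * minorant x) ≤ letterWeight e a x := by
  have h1 : minorant x ≤ 1 := by
    rw [minorant]; exact pow_le_one' (ENNReal.inv_le_one.2 le_self_add) _
  by_cases ha : a = 2
  · subst ha
    have h0 := minorant_le_letterWeight e (a := 0) (by decide) x
    have h0' := minorant_mul_le_propagator x 0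
    simp only [minorant, propagator, enorm_zero, sub_zero, add_zero, inv_one, one_pow,
      one_mul] at h0'
    rw [letterWeight_two]
    calc _ = minorant x * (minorant e * minorant x) := by ring
      _ ≤ _ := mul_le_mul' h0' (minorant_mul_le_propagator x e)
  · refine le_trans ?_ (minorant_le_letterWeight e ha x)
    gcongr
    exact mul_le_of_le_one_left' h1

lemma letterWeight_ne_zero (e : E4) (a : Fin 3) (x : E4) : letterWeight e a x ≠ 0 :=
  ne_bot_of_le_ne_bot (mul_ne_zero (minorant_ne_zero e)
    (mul_ne_zero (minorant_ne_zero x) (minorant_ne_zero x))) (minorant_mul_le_letterWeight e a x)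

lemma propagator_ne_zero (x y : E4) : propagator x y ≠ 0 := by simp [propagator]

lemma lintegral_ne_zero_of_forall {f : E4 → ℝ≥0∞} (hf : Measurable f) (h : ∀ x, f x ≠ 0) :
    ∫⁻ x, f x ≠ 0 := by
  rw [Ne, lintegral_eq_zero_iff hf]
  intro h0
  obtain ⟨x, hx⟩ := h0.exists
  exact h x hx

lemma eq_top_of_minorant_sq_le {f : E4 → ℝ≥0∞} {c : ℝ≥0∞} (hc : c ≠ 0)
    (h : ∀ x, c * (minorant x * minorant x) ≤ f x) : ∫⁻ x, f x = ∞ := by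
  refine top_le_iff.1 (le_trans ?_ (lintegral_mono h))
  rw [lintegral_const_mul _ (by fun_prop), lintegral_minorant_sq, ENNReal.mul_top hc]

lemma appendLetter_one_eq_top (e : E4) {a : Fin 3} (ha : a ≠ 2) :
    appendLetter e a 1 = fun _ => ∞ := by
  funext y
  refine eq_top_of_minorant_sq_le (mul_ne_zero (minorant_ne_zero e) (minorant_ne_zero y))
    fun x => ?_
  rw [Pi.one_apply, one_mul]
  calc _ = (minorant e * minorant x) * (minorant y * minorant x) := by ring
    _ ≤ _ := mul_le_mul' (minorant_le_letterWeight e ha x) (minorant_mul_le_propagator x y)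

/-- As ∞ · 0 = 0, infinity propagates along the chain only because no weight or propagator vanishes.
-/
lemma chainIntegral_top (e : E4) {n : ℕ} (a : Fin (n + 1) → Fin 3) {h : E4 → ℝ≥0∞}
    (hh : Measurable h) (h0 : ∀ x, h x ≠ 0) : chainIntegral e a (fun _ => ∞) h = ∞ := by
  induction n with
  | zero =>
    simp [chainIntegral_zero, ENNReal.top_mul, letterWeight_ne_zero, h0]
  | succ n ih =>
    rw [chainIntegral_succ e a (by fun_prop) hh]
    convert ih (fun i => a i.succ)
    simp [appendLetter, ENNReal.top_mul, letterWeight_ne_zero, propagator_ne_zero]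

lemma chainIntegral_eq_top_of_head_ne (e : E4) {n : ℕ} (a : Fin (n + 2) → Fin 3) {h : E4 → ℝ≥0∞}
    (hh : Measurable h) (h0 : ∀ x, h x ≠ 0) (ha : a 0 ≠ 2) : chainIntegral e a 1 h = ∞ := by
  rw [chainIntegral_succ e a measurable_one hh, appendLetter_one_eq_top e ha]
  exact chainIntegral_top e _ hh h0

lemma chainIntegral_eq_top_of_last_ne (e : E4) {n : ℕ} (a : Fin (n + 1) → Fin 3)
    {g : E4 → ℝ≥0∞} (hg : Measurable g) {c : ℝ≥0∞} (hc : c ≠ 0) (hle : ∀ x, c * minorant x ≤ g x)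
    (ha : a (Fin.last n) ≠ 2) : chainIntegral e a g 1 = ∞ := by
  induction n generalizing g c with
  | zero =>
    rw [chainIntegral_zero]
    refine eq_top_of_minorant_sq_le (mul_ne_zero hc (minorant_ne_zero e)) fun x => ?_
    rw [Pi.one_apply, mul_one]
    calc _ = (c * minorant x) * (minorant e * minorant x) := by ring
      _ ≤ _ := mul_le_mul' (hle x) (minorant_le_letterWeight e ha x)
  | succ n ih =>
    rw [chainIntegral_succ e a hg measurable_one]
    -- The lower bound c · `minorant` is the invariant; the new c, possibly ∞, is what remains after
    -- `minorant y` is pulled out of the integral.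
    refine ih (fun i => a i.succ) (measurable_appendLetter e _ hg)
      (c := ∫⁻ x, c * minorant x * letterWeight e (a 0) x * minorant x) ?_ (fun y => ?_) ha
    · exact lintegral_ne_zero_of_forall (by fun_prop) fun x =>
        mul_ne_zero (mul_ne_zero (mul_ne_zero hc (minorant_ne_zero x)) (letterWeight_ne_zero _ _ x))
          (minorant_ne_zero x)
    · rw [← lintegral_mul_const _ (by fun_prop)]
      refine lintegral_mono fun x => ?_
      rw [mul_assoc _ (minorant x) (minorant y), mul_comm (minorant x) (minorant y)]
      gcongr
      · exact hle x
      · exact minorant_mul_le_propagator x y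

/-! ### The convergence criteria -/

lemma majorant_lt_top {e z : E4} (hz0 : z ≠ 0) (hze : z ≠ e) : majorant e 1 z < ∞ := by
  simp [majorant, hz0, sub_eq_zero, hze]

lemma chainIntegral_propagator_lt_top_iff {e z : E4} (he : ‖e‖ = 1) (hz0 : z ≠ 0) (hze : z ≠ e)
    {n : ℕ} (a : Fin (n + 1) → Fin 3) :
    chainIntegral e a 1 (propagator z) < ∞ ↔ a 0 = 2 := by
  have hfin := fun {g} (hg : IsMajorized e g) =>
    let ⟨C, hC, h⟩ := hg
    (h z).trans_lt (ENNReal.mul_lt_top hC (majorant_lt_top hz0 hze))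
  have hmaj : IsMajorized e (majorant e 1) := ⟨1, by simp, by simp⟩
  rcases n with _ | n
  · have h : chainIntegral e a 1 (propagator z) = appendLetter e (a 0) 1 z := by
      rw [chainIntegral_zero, appendLetter]
      simp only [propagator_comm z]
    rw [h]
    refine ⟨fun hlt => ?_, fun h0 => ?_⟩
    · by_contra ha
      simp [appendLetter_one_eq_top e ha] at hlt
    · rw [h0]; exact hfin (isMajorized_appendLetter_two he)
  · refine ⟨fun hlt => ?_, fun h0 => ?_⟩
    · by_contra ha
      rw [chainIntegral_eq_top_of_head_ne e a (by fun_prop) (propagator_ne_zero z) ha] at hlt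
      exact lt_irrefl _ hlt
    · rw [chainIntegral_succ e a measurable_one (by fun_prop), h0]
      refine chainIntegral_lt_top he _ (measurable_appendLetter e _ measurable_one) (by fun_prop)
        (isMajorized_appendLetter_two he) ?_
      -- The last integral is `appendLetter` of the majorant at z, hence finite by the invariance of
      -- the bound.
      simp only [propagator_comm z]
      exact hfin (hmaj.appendLetter he _)

lemma chainIntegral_one_lt_top_iff {e : E4} (he : ‖e‖ = 1) {n : ℕ} (a : Fin (n + 1) → Fin 3) :
    chainIntegral e a 1 1 < ∞ ↔ 1 ≤ n ∧ a 0 = 2 ∧ a (Fin.last n) = 2 := by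
  rcases n with _ | n
  -- A single vertex has at most two edges, so even letter 2 decays only like ‖x‖⁻⁴.
  · have h : chainIntegral e a 1 1 = ∞ := by
      rw [chainIntegral_zero]
      refine eq_top_of_minorant_sq_le (minorant_ne_zero e) fun x => ?_
      simpa using minorant_mul_le_letterWeight e (a 0) x
    simp [h]
  · refine ⟨fun hlt => ⟨by omega, ?_, ?_⟩, fun ⟨_, h0, h1⟩ => ?_⟩
    · by_contra ha
      exact hlt.ne (chainIntegral_eq_top_of_head_ne e a measurable_one (by simp) ha)
    · by_contra ha
      refine hlt.ne (chainIntegral_eq_top_of_last_ne e a measurable_one one_ne_zero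
        (fun x => ?_) ha)
      rw [one_mul, minorant, Pi.one_apply]
      exact pow_le_one' (ENNReal.inv_le_one.2 le_self_add) _
    · rw [chainIntegral_succ e a measurable_one measurable_one, h0]
      refine chainIntegral_lt_top he _ (measurable_appendLetter e _ measurable_one) measurable_one
        (isMajorized_appendLetter_two he) ?_
      rw [Fin.succ_last, h1]
      simpa using lintegral_majorant_mul_letterWeight_two_lt_top he

theorem mainTheorem12 (w : List (Fin 3)) (hw : w ≠ []) (e₁ : E4) (he₁ : ‖e₁‖ = 1) :
    (∀ z : E4, z ≠ 0 → z ≠ e₁ → (sequentialFunction w e₁ z < ∞ ↔ w.head? = some 2)) ∧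
    (sequentialPeriod w e₁ < ∞ ↔
      2 ≤ w.length ∧ w.head? = some 2 ∧ w.getLast? = some 2) := by
  obtain ⟨a, l, rfl⟩ := List.exists_cons_of_ne_nil hw
  refine ⟨fun z hz0 hze => ?_, ?_⟩
  · rw [sequentialFunction_lt_top_iff,
      chainIntegral_propagator_lt_top_iff (n := l.length) he₁ hz0 hze]
    simp
  · rw [sequentialPeriod_lt_top_iff, chainIntegral_one_lt_top_iff (n := l.length) he₁]
    simp [List.getLast?_eq_getElem?]
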